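/- Let $A$ be an associative ring with $1$ (not necessarily commutative) and let $n\ge 0$ be an integer. Let $\mathbb{S}_n(A)$, the algebra of one-sided inverses of the polynomial algebra $A[x_1,\dots,x_n]$, be the ring generated over $A$ by $2n$ elements $x_1,\dots,x_n,y_1,\dots,y_n$ that commute with the elements of $A$ and satisfy the defining relations $$y_1x_1=1,\ \dots,\ y_nx_n=1,\qquad x_iy_j=y_jx_i,\quad x_ix_j=x_jx_i,\quad y_iy_j=y_jy_i\quad\text{for all } i\neq j.$$ For a ring $R$, let $\operatorname{l.gldim}(R)$ (respectively, $\operatorname{r.gldim}(R)$) denote its left (respectively, right) global dimension, i.e. the supremum in $\{-\infty\}\cup\mathbb{N}\cup\{\infty\}$ of the projective dimensions of all left (respectively, right) $R$-modules, where the zero module has projective dimension $-\infty$. Then $$\operatorname{l.gldim}(\mathbb{S}_n(A))=\operatorname{l.gldim}(A)+n\quad\text{and}\quad \operatorname{r.gldim}(\mathbb{S}_n(A))=\operatorname{r.gldim}(A)+n,$$ where $\pm\infty+n=\pm\infty$. -/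

import Mathlib

universe u

/-- The left global dimension of a ring: the supremum of the projective dimensions of all its left
modules. It takes values in `WithBot ℕ∞`; the zero module has projective dimension `⊥`, so the
value is `⊥` exactly for the zero ring. -/
noncomputable def leftGlobalDimension (R : Type u) [Ring R] : WithBot ℕ∞ :=
  ⨆ M : ModuleCat.{u} R, CategoryTheory.projectiveDimension M

/-- The right global dimension of a ring: right `R`-modules are left modules over the opposite
ring. -/
noncomputable def rightGlobalDimension (R : Type u) [Ring R] : WithBot ℕ∞ :=
  leftGlobalDimension Rᵐᵒᵖ

namespace OneSidedInverses

/-- The free ring over the (possibly noncommutative) ring `A` on `2 n` noncommuting variables, all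
of which commute with the coefficients from `A`. -/
abbrev FreeRing (A : Type u) [Ring A] (n : ℕ) : Type u :=
  MonoidAlgebra A (FreeMonoid (Fin n ⊕ Fin n))

/-- The variable `x i` of the free ring. -/
noncomputable def freeX (A : Type u) [Ring A] (n : ℕ) (i : Fin n) : FreeRing A n :=
  MonoidAlgebra.of A (FreeMonoid (Fin n ⊕ Fin n)) (FreeMonoid.of (Sum.inl i))

/-- The variable `y i` of the free ring. -/
noncomputable def freeY (A : Type u) [Ring A] (n : ℕ) (i : Fin n) : FreeRing A n :=
  MonoidAlgebra.of A (FreeMonoid (Fin n ⊕ Fin n)) (FreeMonoid.of (Sum.inr i))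

/-- The defining relations: `y i * x i = 1` for all `i`, and generators with different indices
commute. -/
inductive Rel (A : Type u) [Ring A] (n : ℕ) : FreeRing A n → FreeRing A n → Prop
  | left_inverse (i : Fin n) : Rel A n (freeY A n i * freeX A n i) 1
  | comm_xy (i j : Fin n) (h : i ≠ j) :
      Rel A n (freeX A n i * freeY A n j) (freeY A n j * freeX A n i)
  | comm_xx (i j : Fin n) (h : i ≠ j) :
      Rel A n (freeX A n i * freeX A n j) (freeX A n j * freeX A n i)
  | comm_yy (i j : Fin n) (h : i ≠ j) :
      Rel A n (freeY A n i * freeY A n j) (freeY A n j * freeY A n i)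

end OneSidedInverses

/-- The algebra `𝕊ₙ(A)` of one-sided inverses of the polynomial algebra `A[x₁, …, xₙ]`: the ring
generated over `A` by elements `x i`, `y i` commuting with `A`, subject to the defining
relations. -/
abbrev OneSidedInverseAlgebra (A : Type u) [Ring A] (n : ℕ) : Type u :=
  RingQuot (OneSidedInverses.Rel A n)

/-! The algebra on n + 1 pairs arises from the one on n pairs by freely adjoining a pair with y x =
1 (`exists_extension_succ`), so it is enough that one such extension S of A raises the left global
dimension by exactly one (`leftGlobalDimension_eq`). The right-hand equality follows because the
opposite of such an extension is again one, with x and y exchanged (`op`).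

Upper bound: pd_S W ≤ pd_A W + 1. For an A-module M with endomorphism t, let M[x]_t be the S-module
of polynomials on which y divides by x and acts by t on constants (`poly`). If W is projective over
A, there is an exact sequence 0 → W[x]_0 → W[x]_y → W → 0 with maps X - x and evaluation at x. Here
W[x]_0 = S(1 - xy) ⊗ W is projective, and W[x]_y is the cokernel of an injective endomorphism of S ⊗
W, which is W[y][x] because the x^i y^j form an A-basis of S. Hence pd_S W ≤ 1, and syzygies give
the general case.

Lower bound: let x and y act as the identity on an A-module N; the resulting S-module has dimension
at least pd_A N + 1. Syzygies reduce this to two cases: if it is projective then N = 0, and if it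
has dimension at most 1 then N is projective. Both come from lifting through the unipotent
self-extension N × N (`shear`), which solves c(xz) - c(z) = d(z). -/

/-- `S` is generated over the image of `φ : A →+* S` by elements `x`, `y` that commute with the
coefficients and satisfy `y * x = 1`, and it is universal with this property. -/
structure IsOneSidedInverseExtension {A S : Type u} [Ring A] [Ring S] (φ : A →+* S) (x y : S) :
    Prop where
  commute_x (a : A) : Commute (φ a) x
  commute_y (a : A) : Commute (φ a) y
  left_inverse : y * x = 1
  eq_top (p : Subring S) (hφ : ∀ a, φ a ∈ p) (hx : x ∈ p) (hy : y ∈ p) : p = ⊤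
  exists_lift {B : Type u} [Ring B] (f : A →+* B) (X Y : B) (hX : ∀ a, Commute (f a) X)
    (hY : ∀ a, Commute (f a) Y) (hYX : Y * X = 1) :
    ∃ g : S →+* B, g.comp φ = f ∧ g x = X ∧ g y = Y

namespace IsOneSidedInverseExtension

open CategoryTheory

/-! ### Polynomials over a module and the characteristic sequence of an endomorphism -/

section Finsupp

variable {A : Type u} [Ring A] {M : Type u} [AddCommGroup M] [Module A M]

variable (A M) in
/-- Multiplication by the variable on polynomials with coefficients in `M`. -/
noncomputable def shiftUp : (ℕ →₀ M) →ₗ[A] (ℕ →₀ M) :=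
  Finsupp.lmapDomain M A Nat.succ

@[simp]
lemma shiftUp_single (i : ℕ) (m : M) :
    shiftUp A M (Finsupp.single i m) = Finsupp.single (i + 1) m := by
  simp [shiftUp, Finsupp.lmapDomain_apply, Finsupp.mapDomain_single]

/-- Division by the variable on polynomials with coefficients in `M`, acting by `t` on constant
polynomials. -/
noncomputable def shiftDown (t : M →ₗ[A] M) : (ℕ →₀ M) →ₗ[A] (ℕ →₀ M) :=
  Finsupp.lsum ℕ fun i => Nat.casesOn i (Finsupp.lsingle 0 ∘ₗ t) fun j => Finsupp.lsingle j

@[simp]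
lemma shiftDown_single_zero (t : M →ₗ[A] M) (m : M) :
    shiftDown t (Finsupp.single 0 m) = Finsupp.single 0 (t m) := by
  simp [shiftDown]

@[simp]
lemma shiftDown_single_succ (t : M →ₗ[A] M) (i : ℕ) (m : M) :
    shiftDown t (Finsupp.single (i + 1) m) = Finsupp.single i m := by
  simp [shiftDown]

lemma shiftDown_shiftUp (t : M →ₗ[A] M) (f : ℕ →₀ M) : shiftDown t (shiftUp A M f) = f := by
  induction f using Finsupp.induction_linear with
  | zero => simp
  | add f g hf hg => simp [hf, hg]
  | single i m => simp

/-- The map `X - t` on polynomials with coefficients in `M`. -/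
noncomputable def charMap (t : M →ₗ[A] M) : (ℕ →₀ M) →ₗ[A] (ℕ →₀ M) :=
  shiftUp A M - Finsupp.mapRange.linearMap t

@[simp]
lemma charMap_single (t : M →ₗ[A] M) (i : ℕ) (m : M) :
    charMap t (Finsupp.single i m) = Finsupp.single (i + 1) m - Finsupp.single i (t m) := by
  simp [charMap]

/-- Evaluation of polynomials with coefficients in `M` at the endomorphism `t`. -/
noncomputable def evalMap (t : M →ₗ[A] M) : (ℕ →₀ M) →ₗ[A] M :=
  Finsupp.lsum ℕ fun i => t ^ i

@[simp]
lemma evalMap_single (t : M →ₗ[A] M) (i : ℕ) (m : M) :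
    evalMap t (Finsupp.single i m) = (t ^ i) m := by
  simp [evalMap]

lemma evalMap_surjective (t : M →ₗ[A] M) : Function.Surjective (evalMap t) := fun m =>
  ⟨Finsupp.single 0 m, by simp⟩

lemma evalMap_shiftUp (t : M →ₗ[A] M) (f : ℕ →₀ M) :
    evalMap t (shiftUp A M f) = t (evalMap t f) := by
  induction f using Finsupp.induction_linear with
  | zero => simp
  | add f g hf hg => simp [hf, hg]
  | single i m => simp [pow_succ']

lemma charMap_shiftUp (t : M →ₗ[A] M) (f : ℕ →₀ M) :
    charMap t (shiftUp A M f) = shiftUp A M (charMap t f) := by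
  induction f using Finsupp.induction_linear with
  | zero => simp
  | add f g hf hg => simp [hf, hg]
  | single i m => simp

/-- A kernel element has coefficients f_i = t f_{i+1}, hence f_i = t^k f_{i+k}, which vanishes once
i + k exceeds the degree. -/
lemma charMap_injective (t : M →ₗ[A] M) : Function.Injective (charMap t) := by
  rw [injective_iff_map_eq_zero]
  intro f hf
  have step (i : ℕ) : f i = t (f (i + 1)) := by
    have := DFunLike.congr_fun hf (i + 1)
    simp only [charMap, shiftUp, LinearMap.sub_apply, Finsupp.lmapDomain_apply,
      Finsupp.sub_apply, Finsupp.mapRange.linearMap_apply, Finsupp.mapRange_apply,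
      Finsupp.zero_apply, sub_eq_zero] at this
    rwa [← Nat.succ_eq_add_one, Finsupp.mapDomain_apply Nat.succ_injective] at this
  have steps (i k : ℕ) : f i = (t ^ k) (f (i + k)) := by
    induction k with
    | zero => simp
    | succ k ih => rw [ih, step, pow_succ, Module.End.mul_apply, add_assoc]
  ext i
  rw [steps i (f.support.sup id + 1)]
  have : f (i + (f.support.sup id + 1)) = 0 := by
    by_contra h
    have := Finset.le_sup (f := id) (Finsupp.mem_support_iff.mpr h)
    simp only [id] at this
    omega
  simp [this]

/-- Modulo the range of X - t, the monomial X^{i+1} m equals X^i (t m), so by induction every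
polynomial is congruent to the constant given by its value at t. -/
lemma exact_charMap_evalMap (t : M →ₗ[A] M) : Function.Exact (charMap t) (evalMap t) := by
  intro f
  constructor
  · have key (f : ℕ →₀ M) : f - Finsupp.single 0 (evalMap t f) ∈ LinearMap.range (charMap t) := by
      induction f using Finsupp.induction_linear with
      | zero => simp
      | add f g hf hg =>
        convert add_mem hf hg using 1
        rw [map_add, Finsupp.single_add]
        abel
      | single i m =>
        induction i generalizing m with
        | zero => simp
        | succ i ih =>
          convert add_mem (LinearMap.mem_range_self (charMap t) (Finsupp.single i m)) (ih (t m))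
            using 1
          simp [pow_succ]
    intro hf
    simpa [hf] using key f
  · rintro ⟨f, rfl⟩
    induction f using Finsupp.induction_linear with
    | zero => simp
    | add f g hf hg => simp [hf, hg]
    | single i m => simp [pow_succ]

lemma mapRange_exact {M' M'' : Type u} [AddCommGroup M'] [Module A M'] [AddCommGroup M'']
    [Module A M''] {f : M →ₗ[A] M'} {g : M' →ₗ[A] M''} (h : Function.Exact f g) :
    Function.Exact (Finsupp.mapRange.linearMap (α := ℕ) f) (Finsupp.mapRange.linearMap g) := by
  intro v
  constructor
  · intro hv
    have hv' (i : ℕ) : g (v i) = 0 := by simpa using DFunLike.congr_fun hv i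
    clear hv
    have : v = ∑ i ∈ v.support, Finsupp.single i (v i) := (Finsupp.sum_single v).symm
    rw [this]
    refine (LinearMap.range (Finsupp.mapRange.linearMap f)).sum_mem fun i _ => ?_
    obtain ⟨m, hm⟩ := (h _).mp (hv' i)
    exact ⟨Finsupp.single i m, by simp [hm]⟩
  · rintro ⟨w, rfl⟩
    ext i
    simpa using (h (f (w i))).mpr ⟨_, rfl⟩

end Finsupp

/-! ### Opposites, and modules over an extension described by generators -/

variable {A S : Type u} [Ring A] [Ring S] {φ : A →+* S} {x y : S}

/-- Reversing products turns y x = 1 into the same relation with the two generators exchanged. This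
reduces right modules to left modules. -/
lemma op (h : IsOneSidedInverseExtension φ x y) :
    IsOneSidedInverseExtension φ.op (MulOpposite.op y) (MulOpposite.op x) where
  commute_x a := (h.commute_y a.unop).op
  commute_y a := (h.commute_x a.unop).op
  left_inverse := by rw [← MulOpposite.op_mul, h.left_inverse, MulOpposite.op_one]
  eq_top p hφ hx hy := by
    have := h.eq_top p.unop (fun a => hφ (MulOpposite.op a)) hy hx
    rw [← Subring.op_unop p, this, Subring.op_top]
  exists_lift {B} _ f X Y hX hY hYX := by
    obtain ⟨g, hg, hgx, hgy⟩ := h.exists_lift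
      (f.op.comp (RingEquiv.opOp A).toRingHom) (MulOpposite.op Y) (MulOpposite.op X)
      (fun a => (hY (MulOpposite.op a)).op) (fun a => (hX (MulOpposite.op a)).op)
      (by rw [← MulOpposite.op_mul, hYX, MulOpposite.op_one])
    refine ⟨(RingEquiv.opOp B).symm.toRingHom.comp g.op, ?_, ?_, ?_⟩
    · ext a
      exact congrArg MulOpposite.unop (RingHom.congr_fun hg a.unop)
    · exact congrArg MulOpposite.unop hgy
    · exact congrArg MulOpposite.unop hgx

section Linear

variable {W V : Type u} [AddCommGroup W] [Module S W] [AddCommGroup V] [Module S V]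

/-- The scalars that `f` respects form a subring, and it contains the generators. -/
lemma map_smul_of_generators (h : IsOneSidedInverseExtension φ x y) (f : W →+ V)
    (hφ : ∀ a w, f (φ a • w) = φ a • f w) (hx : ∀ w, f (x • w) = x • f w)
    (hy : ∀ w, f (y • w) = y • f w) (s : S) (w : W) : f (s • w) = s • f w := by
  let p : Subring S :=
    { carrier := {s | ∀ w, f (s • w) = s • f w}
      mul_mem' := fun {a b} ha hb w => by rw [mul_smul, ha, hb, mul_smul]
      one_mem' := fun w => by simp
      add_mem' := fun {a b} ha hb w => by rw [add_smul, map_add, ha, hb, add_smul]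
      zero_mem' := fun w => by simp
      neg_mem' := fun {a} ha w => by rw [neg_smul, map_neg, ha, neg_smul] }
  have : s ∈ p := by
    rw [h.eq_top p hφ hx hy]
    trivial
  exact this w

/-- An additive map compatible with the coefficients and the two generators is linear. -/
def linearMap (h : IsOneSidedInverseExtension φ x y) (f : W →+ V)
    (hφ : ∀ a w, f (φ a • w) = φ a • f w) (hx : ∀ w, f (x • w) = x • f w)
    (hy : ∀ w, f (y • w) = y • f w) : W →ₗ[S] V :=
  { f with map_smul' := h.map_smul_of_generators f hφ hx hy }

@[simp]
lemma linearMap_apply (h : IsOneSidedInverseExtension φ x y) (f : W →+ V)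
    (hφ : ∀ a w, f (φ a • w) = φ a • f w) (hx : ∀ w, f (x • w) = x • f w)
    (hy : ∀ w, f (y • w) = y • f w) (w : W) : h.linearMap f hφ hx hy w = f w := rfl

end Linear

section OfEnd

variable {M : Type u} [AddCommGroup M] [Module A M]

lemma exists_action (h : IsOneSidedInverseExtension φ x y) (X Y : M →ₗ[A] M) (hYX : ∀ m, Y (X m) = m) :
    ∃ g : S →+* AddMonoid.End M, (∀ a m, g (φ a) m = a • m) ∧ (∀ m, g x m = X m) ∧
      ∀ m, g y m = Y m := by
  obtain ⟨g, hg, hx, hy⟩ := h.exists_lift (Module.toAddMonoidEnd A M)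
    (X.toAddMonoidHom : AddMonoid.End M) (Y.toAddMonoidHom : AddMonoid.End M)
    (fun a => by ext m; exact (X.map_smul a m).symm)
    (fun a => by ext m; exact (Y.map_smul a m).symm) (by ext m; exact hYX m)
  refine ⟨g, fun a m => ?_, fun m => ?_, fun m => ?_⟩
  · rw [← RingHom.comp_apply, hg]; rfl
  · rw [hx]; rfl
  · rw [hy]; rfl

/-- The `S`-module given by an `A`-module with endomorphisms `X`, `Y` such that `Y ∘ X = 1`. -/
noncomputable def ofEnd (h : IsOneSidedInverseExtension φ x y) (X Y : M →ₗ[A] M) (hYX : ∀ m, Y (X m) = m) : ModuleCat.{u} S :=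
  letI := Module.compHom M (h.exists_action X Y hYX).choose
  ModuleCat.of S M

variable (h : IsOneSidedInverseExtension φ x y) (X Y : M →ₗ[A] M) (hYX : ∀ m, Y (X m) = m)

/-- The underlying additive group of `ofEnd`. -/
def toOfEnd : M ≃+ h.ofEnd X Y hYX := AddEquiv.refl M

lemma smul_toOfEnd (a : A) (m : M) :
    φ a • h.toOfEnd X Y hYX m = h.toOfEnd X Y hYX (a • m) :=
  (h.exists_action X Y hYX).choose_spec.1 a m

lemma x_smul_toOfEnd (m : M) : x • h.toOfEnd X Y hYX m = h.toOfEnd X Y hYX (X m) :=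
  (h.exists_action X Y hYX).choose_spec.2.1 m

lemma y_smul_toOfEnd (m : M) : y • h.toOfEnd X Y hYX m = h.toOfEnd X Y hYX (Y m) :=
  (h.exists_action X Y hYX).choose_spec.2.2 m

end OfEnd

/-! ### Polynomial modules, induced modules and their projectivity -/

section Poly

variable {M : Type u} [AddCommGroup M] [Module A M]

/-- The `S`-module of polynomials in `x` with coefficients in `M`, where `y` acts by `t` on
constant polynomials. -/
noncomputable def poly (h : IsOneSidedInverseExtension φ x y) (t : M →ₗ[A] M) : ModuleCat.{u} S :=
  h.ofEnd (shiftUp A M) (shiftDown t) (shiftDown_shiftUp t)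

/-- The underlying additive group of `poly`. -/
noncomputable def toPoly (h : IsOneSidedInverseExtension φ x y) (t : M →ₗ[A] M) :
    (ℕ →₀ M) ≃+ h.poly t :=
  h.toOfEnd _ _ _

variable (h : IsOneSidedInverseExtension φ x y) (t : M →ₗ[A] M)

lemma smul_toPoly (a : A) (f : ℕ →₀ M) : φ a • h.toPoly t f = h.toPoly t (a • f) :=
  h.smul_toOfEnd _ _ _ a f

lemma x_smul_toPoly (f : ℕ →₀ M) : x • h.toPoly t f = h.toPoly t (shiftUp A M f) :=
  h.x_smul_toOfEnd _ _ _ f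

lemma y_smul_toPoly (f : ℕ →₀ M) : y • h.toPoly t f = h.toPoly t (shiftDown t f) :=
  h.y_smul_toOfEnd _ _ _ f

lemma y_smul_x_smul (h : IsOneSidedInverseExtension φ x y) {W : Type u} [AddCommGroup W]
    [Module S W] (w : W) : y • x • w = w := by
  rw [← mul_smul, h.left_inverse, one_smul]

/-- Linear maps out of `ofEnd` are additive maps compatible with the actions. -/
noncomputable def ofEndDesc (h : IsOneSidedInverseExtension φ x y) {X Y : M →ₗ[A] M}
    {hYX : ∀ m, Y (X m) = m} {W : Type u}
    [AddCommGroup W] [Module S W] (g : M →+ W) (hφ : ∀ a m, g (a • m) = φ a • g m)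
    (hx : ∀ m, g (X m) = x • g m) (hy : ∀ m, g (Y m) = y • g m) :
    h.ofEnd X Y hYX →ₗ[S] W :=
  h.linearMap (g.comp (h.toOfEnd X Y hYX).symm.toAddMonoidHom)
    (fun a w => by
      obtain ⟨w, rfl⟩ := (h.toOfEnd X Y hYX).surjective w
      simp [smul_toOfEnd, hφ])
    (fun w => by
      obtain ⟨w, rfl⟩ := (h.toOfEnd X Y hYX).surjective w
      simp [x_smul_toOfEnd, hx])
    (fun w => by
      obtain ⟨w, rfl⟩ := (h.toOfEnd X Y hYX).surjective w
      simp [y_smul_toOfEnd, hy])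

@[simp]
lemma ofEndDesc_toOfEnd (h : IsOneSidedInverseExtension φ x y) {X Y : M →ₗ[A] M}
    {hYX : ∀ m, Y (X m) = m} {W : Type u}
    [AddCommGroup W] [Module S W] (g : M →+ W) (hφ : ∀ a m, g (a • m) = φ a • g m)
    (hx : ∀ m, g (X m) = x • g m) (hy : ∀ m, g (Y m) = y • g m) (m : M) :
    h.ofEndDesc (hYX := hYX) g hφ hx hy (h.toOfEnd X Y hYX m) = g m := by
  simp [ofEndDesc]

/-- The linear map out of `poly` determined by its restriction to constant polynomials. -/
noncomputable def polyDesc {W : Type u}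
    [AddCommGroup W] [Module S W] (g : M →+ W) (hφ : ∀ a m, g (a • m) = φ a • g m)
    (hy : ∀ m, g (t m) = y • g m) : h.poly t →ₗ[S] W :=
  h.ofEndDesc (Finsupp.liftAddHom fun i => (DistribSMul.toAddMonoidHom W (x ^ i)).comp g)
    (fun a f => by
      induction f using Finsupp.induction_linear with
      | zero => simp
      | add f g hf hg => simp only [smul_add, map_add, hf, hg]
      | single i m =>
        simp [hφ, ← mul_smul, ((h.commute_x a).pow_right i).eq])
    (fun f => by
      induction f using Finsupp.induction_linear with
      | zero => simp
      | add f g hf hg => simp only [smul_add, map_add, hf, hg]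
      | single i m => simp [pow_succ', mul_smul])
    (fun f => by
      induction f using Finsupp.induction_linear with
      | zero => simp
      | add f g hf hg => simp only [smul_add, map_add, hf, hg]
      | single i m => cases i <;> simp [hy, pow_succ', mul_smul, h.y_smul_x_smul])

@[simp]
lemma polyDesc_single {W : Type u}
    [AddCommGroup W] [Module S W] (g : M →+ W) (hφ : ∀ a m, g (a • m) = φ a • g m)
    (hy : ∀ m, g (t m) = y • g m) (i : ℕ) (m : M) :
    h.polyDesc t g hφ hy (h.toPoly t (Finsupp.single i m)) = x ^ i • g m :=
  (h.ofEndDesc_toOfEnd _ _ _ _ _).trans (by simp)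

lemma x_pow_smul_toPoly (m : M) (i : ℕ) :
    x ^ i • h.toPoly t (Finsupp.single 0 m) = h.toPoly t (Finsupp.single i m) := by
  induction i with
  | zero => simp
  | succ i ih => rw [pow_succ', mul_smul, ih, x_smul_toPoly, shiftUp_single]

lemma poly_hom_ext {W : Type u} [AddCommGroup W] [Module S W] {f g : h.poly t →ₗ[S] W}
    (hfg : ∀ m, f (h.toPoly t (Finsupp.single 0 m)) = g (h.toPoly t (Finsupp.single 0 m))) :
    f = g := by
  ext w
  obtain ⟨w, rfl⟩ := (h.toPoly t).surjective w
  induction w using Finsupp.induction_linear with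
  | zero => simp
  | add f g hf hg => simp_all
  | single i m => rw [← x_pow_smul_toPoly, map_smul, map_smul, hfg]

/-- The polynomial module is functorial in the module with endomorphism. -/
noncomputable def polyMap {M' : Type u} [AddCommGroup M'] [Module A M'] {t : M →ₗ[A] M}
    {t' : M' →ₗ[A] M'} (g : M →ₗ[A] M') (hg : ∀ m, g (t m) = t' (g m)) :
    h.poly t →ₗ[S] h.poly t' :=
  h.ofEndDesc ((h.toPoly t').toAddMonoidHom.comp (Finsupp.mapRange.linearMap g).toAddMonoidHom)
    (fun a f => by
      simp only [smul_toPoly, AddMonoidHom.comp_apply, LinearMap.toAddMonoidHom_coe, map_smul,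
        AddEquiv.toAddMonoidHom_eq_coe, AddMonoidHom.coe_coe])
    (fun f => by
      induction f using Finsupp.induction_linear with
      | zero => simp
      | add f g hf hg => simp only [smul_add, map_add, hf, hg]
      | single i m => simp [x_smul_toPoly])
    (fun f => by
      induction f using Finsupp.induction_linear with
      | zero => simp
      | add f g hf hg => simp only [smul_add, map_add, hf, hg]
      | single i m => cases i <;> simp [y_smul_toPoly, hg])

@[simp]
lemma polyMap_toPoly {M' : Type u} [AddCommGroup M'] [Module A M'] {t : M →ₗ[A] M}
    {t' : M' →ₗ[A] M'} (g : M →ₗ[A] M') (hg : ∀ m, g (t m) = t' (g m)) (f : ℕ →₀ M) :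
    h.polyMap g hg (h.toPoly t f) = h.toPoly t' (Finsupp.mapRange.linearMap g f) :=
  h.ofEndDesc_toOfEnd _ _ _ _ _

/-- The induced module `S ⊗ M`. -/
noncomputable abbrev induced (M : Type u) [AddCommGroup M] [Module A M] : ModuleCat.{u} S :=
  h.poly (shiftUp A M)

/-- The adjunction map of an additive map compatible with the coefficients. -/
noncomputable def inducedDesc {W : Type u}
    [AddCommGroup W] [Module S W] (g : M →+ W) (hφ : ∀ a m, g (a • m) = φ a • g m) :
    h.induced M →ₗ[S] W :=
  h.polyDesc _ (Finsupp.liftAddHom fun i => (DistribSMul.toAddMonoidHom W (y ^ i)).comp g)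
    (fun a f => by
      induction f using Finsupp.induction_linear with
      | zero => simp
      | add f g hf hg => simp only [smul_add, map_add, hf, hg]
      | single i m =>
        simp [hφ, ← mul_smul, ((h.commute_y a).pow_right i).eq])
    (fun f => by
      induction f using Finsupp.induction_linear with
      | zero => simp
      | add f g hf hg => simp only [smul_add, map_add, hf, hg]
      | single i m => simp [pow_succ', mul_smul])

/-- The generators of the induced module. -/
noncomputable def inducedMk : M →+ h.induced M :=
  (h.toPoly (shiftUp A M)).toAddMonoidHom.comp
    ((Finsupp.singleAddHom 0).comp (Finsupp.singleAddHom 0))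

lemma inducedMk_apply (m : M) : h.inducedMk m =
    h.toPoly (shiftUp A M) (Finsupp.single 0 (Finsupp.single 0 m)) := rfl

lemma inducedMk_smul (a : A) (m : M) : h.inducedMk (a • m) = φ a • h.inducedMk m := by
  simp [inducedMk_apply, smul_toPoly]

@[simp]
lemma inducedDesc_inducedMk {W : Type u}
    [AddCommGroup W] [Module S W] (g : M →+ W) (hφ : ∀ a m, g (a • m) = φ a • g m) (m : M) :
    h.inducedDesc g hφ (h.inducedMk m) = g m := by
  simp [inducedDesc, inducedMk_apply]

/-- In the induced module the outer exponent counts x and the inner one counts y, so x^i y^j m is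
the double monomial with exponents i, j. -/
lemma y_pow_smul_inducedMk (m : M) (i : ℕ) :
    y ^ i • h.inducedMk m = h.toPoly (shiftUp A M) (Finsupp.single 0 (Finsupp.single i m)) := by
  induction i with
  | zero => simp [inducedMk_apply]
  | succ i ih => simp [pow_succ', mul_smul, ih, y_smul_toPoly]

lemma induced_hom_ext {W : Type u} [AddCommGroup W] [Module S W] {f g : h.induced M →ₗ[S] W}
    (hfg : ∀ m, f (h.inducedMk m) = g (h.inducedMk m)) : f = g := by
  refine h.poly_hom_ext _ fun v => ?_
  induction v using Finsupp.induction_linear with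
  | zero => simp
  | add f g hf hg => simp_all
  | single i m => rw [← y_pow_smul_inducedMk, map_smul, map_smul, hfg]

/-- Along `φ`, linear maps from a projective module lift through surjections. -/
lemma exists_lift_of_projective [Module.Projective A M] {W V : Type u} [AddCommGroup W]
    [Module S W] [AddCommGroup V] [Module S V] (p : W →ₗ[S] V) (hp : Function.Surjective p)
    (g : M →+ V) (hφ : ∀ a m, g (a • m) = φ a • g m) :
    ∃ g' : M →+ W, (∀ a m, g' (a • m) = φ a • g' m) ∧ ∀ m, p (g' m) = g m := by
  let := Module.compHom W φ
  let := Module.compHom V φ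
  let p' : W →ₗ[A] V := { p with map_smul' := fun a w => p.map_smul (φ a) w }
  let g₁ : M →ₗ[A] V := { g with map_smul' := hφ }
  obtain ⟨k, hk⟩ := Module.projective_lifting_property p' g₁ hp
  exact ⟨k.toAddMonoidHom, k.map_smul, LinearMap.congr_fun hk⟩

/-- By adjunction, a section of a surjection onto the induced module amounts to an A-linear lift of
its generators, which exists since M is projective. -/
lemma projective_induced [Module.Projective A M] : Module.Projective S (h.induced M) := by
  refine Module.Projective.of_lifting_property'' fun p hp => ?_
  obtain ⟨g, hφ, hg⟩ := exists_lift_of_projective p hp h.inducedMk h.inducedMk_smul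
  exact ⟨h.inducedDesc g hφ, h.induced_hom_ext fun m => by simp [hg]⟩

/-- Generators are constants killed by y. An A-linear lift of them need not be killed by y, but
multiplying it by the idempotent 1 - xy makes it so, and that idempotent commutes with A and fixes
the constants downstairs. -/
lemma projective_poly_zero [Module.Projective A M] :
    Module.Projective S (h.poly (0 : M →ₗ[A] M)) := by
  refine Module.Projective.of_lifting_property'' fun p hp => ?_
  obtain ⟨g, hφ, hg⟩ := exists_lift_of_projective (φ := φ) p hp
    ((h.toPoly (0 : M →ₗ[A] M)).toAddMonoidHom.comp (Finsupp.singleAddHom 0))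
    (fun a m => by simp [smul_toPoly])
  have hy : y * (1 - x * y) = 0 := by
    rw [mul_sub, ← mul_assoc, h.left_inverse, mul_one, one_mul, sub_self]
  have hcomm (a : A) : Commute (φ a) (1 - x * y) :=
    (Commute.one_right _).sub_right ((h.commute_x a).mul_right (h.commute_y a))
  refine ⟨h.polyDesc 0 ((DistribSMul.toAddMonoidHom _ (1 - x * y)).comp g)
    (fun a m => ?_) (fun m => ?_), h.poly_hom_ext _ fun m => ?_⟩
  · simp [hφ, ← mul_smul, (hcomm a).eq]
  · simp [← mul_smul, hy]
  · simp [hg, sub_smul, mul_smul, y_smul_toPoly]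

end Poly

/-! ### Upper bound: short resolutions and syzygies -/

/-- An element of `S` commuting with the coefficients acts linearly over the coefficients. -/
def smulEnd (W : ModuleCat.{u} S) (s : S) (hs : ∀ a, Commute (φ a) s) :
    (ModuleCat.restrictScalars φ).obj W →ₗ[A] (ModuleCat.restrictScalars φ).obj W where
  toFun w := (s • (show W from w) : W)
  map_add' v w := smul_add s (show W from v) (show W from w)
  map_smul' a w := by
    change s • φ a • (show W from w) = φ a • s • (show W from w)
    rw [← mul_smul, ← mul_smul, (hs a).eq]

lemma smulEnd_pow_apply (W : ModuleCat.{u} S) (s : S) (hs : ∀ a, Commute (φ a) s) (i : ℕ) (w : W) :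
    (smulEnd W s hs ^ i) w = (s ^ i • w : W) := by
  induction i with
  | zero =>
    rw [pow_zero, pow_zero]
    exact (one_smul S w).symm
  | succ i ih =>
    rw [pow_succ', pow_succ', mul_smul]
    exact congrArg (smulEnd W s hs) ih

section Sequences

variable (h : IsOneSidedInverseExtension φ x y)

lemma hasProjectiveDimensionLT_of_exact {R : Type u} [Ring R] {M₁ M₂ M₃ : ModuleCat.{u} R}
    {f : M₁ →ₗ[R] M₂} {g : M₂ →ₗ[R] M₃} (hf : Function.Injective f) (hfg : Function.Exact f g)
    (hg : Function.Surjective g) {n : ℕ} (h₁ : HasProjectiveDimensionLT M₁ n)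
    (h₂ : HasProjectiveDimensionLT M₂ (n + 1)) : HasProjectiveDimensionLT M₃ (n + 1) :=
  (ModuleCat.shortComplex_shortExact (ModuleCat.shortComplexOfCompEqZero f g
    hfg.linearMap_comp_eq_zero) hfg hf hg).hasProjectiveDimensionLT_X₃ n h₁ h₂

/-- The module `poly t` is presented by induced modules. -/
lemma hasProjectiveDimensionLT_poly (M : Type u) [AddCommGroup M] [Module A M]
    [Module.Projective A M] (t : M →ₗ[A] M) : HasProjectiveDimensionLT (h.poly t) 2 := by
  have := h.projective_induced (M := M)
  -- The sequence M[y] → M[y] → M with maps y - t and evaluation at t, applied to the coefficients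
  -- of polynomials in x.
  let f : h.induced M →ₗ[S] h.induced M := h.polyMap (charMap t) (charMap_shiftUp t)
  let g : h.induced M →ₗ[S] h.poly t := h.polyMap (evalMap t) (evalMap_shiftUp t)
  have hf' : ⇑f ∘ h.toPoly _ = h.toPoly _ ∘ Finsupp.mapRange.linearMap (charMap t) := by
    ext; simp [f]
  have hg' : ⇑g ∘ h.toPoly _ = h.toPoly _ ∘ Finsupp.mapRange.linearMap (evalMap t) := by
    ext; simp [g]
  have hinj : Function.Injective f := by
    rw [← Function.Injective.of_comp_iff' f (h.toPoly _).bijective, hf',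
      (h.toPoly _).injective.of_comp_iff]
    exact Finsupp.mapRange_injective _ (map_zero _) (charMap_injective t)
  have hsurj : Function.Surjective g := by
    refine Function.Surjective.of_comp (g := h.toPoly _) ?_
    rw [hg']
    exact (h.toPoly _).surjective.comp
      (Finsupp.mapRange_surjective _ (map_zero _) (evalMap_surjective t))
  have hex : Function.Exact f g := by
    intro v
    obtain ⟨v, rfl⟩ := (h.toPoly _).surjective v
    have hgv := congrFun hg' v
    simp only [Function.comp_apply] at hgv
    rw [hgv, EmbeddingLike.map_eq_zero_iff, mapRange_exact (exact_charMap_evalMap t) v]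
    constructor
    · rintro ⟨w, rfl⟩
      exact ⟨h.toPoly _ w, congrFun hf' w⟩
    · rintro ⟨w, hw⟩
      obtain ⟨w, rfl⟩ := (h.toPoly _).surjective w
      exact ⟨w, (h.toPoly _).injective ((congrFun hf' w).symm.trans hw)⟩
  exact hasProjectiveDimensionLT_of_exact (n := 1) hinj hex hsurj inferInstance inferInstance

/-- The characteristic sequence of x on W becomes S-linear once y acts by its own action on
constants in the middle term and by zero in the left term. The left term is projective and the
middle one has dimension at most 1. -/
lemma hasProjectiveDimensionLT_two (h : IsOneSidedInverseExtension φ x y) (W : ModuleCat.{u} S)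
    [Module.Projective A ((ModuleCat.restrictScalars φ).obj W)] :
    HasProjectiveDimensionLT W 2 := by
  have := h.projective_poly_zero (M := (ModuleCat.restrictScalars φ).obj W)
  let xW := smulEnd W x h.commute_x
  let yW := smulEnd W y h.commute_y
  let α := charMap xW
  have hyx (w) : yW (xW w) = w := h.y_smul_x_smul (W := W) w
  -- The zero action is forced: y sends X w - x w to w - y x w = 0.
  let f : h.poly (0 : (ModuleCat.restrictScalars φ).obj W →ₗ[A] _) →ₗ[S] h.poly yW :=
    h.ofEndDesc ((h.toPoly yW).toAddMonoidHom.comp α.toAddMonoidHom)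
      (fun a v => by simp [smul_toPoly])
      (fun v => by simp [x_smul_toPoly, α, charMap_shiftUp])
      (fun v => by
        induction v using Finsupp.induction_linear with
        | zero => simp
        | add f g hf hg => simp only [smul_add, map_add, hf, hg]
        | single i m => cases i <;> simp [α, smul_sub, y_smul_toPoly, hyx])
  let g : h.poly yW →ₗ[S] W := h.polyDesc yW (AddMonoidHom.id W) (fun a m => rfl) (fun m => rfl)
  have hf' (v) : f (h.toPoly 0 v) = h.toPoly yW (charMap xW v) := h.ofEndDesc_toOfEnd _ _ _ _ _
  have hg' (v) : g (h.toPoly yW v) = evalMap xW v := by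
    induction v using Finsupp.induction_linear with
    | zero =>
      rw [map_zero, map_zero, map_zero]
      rfl
    | add f g hf hg =>
      rw [map_add, map_add, map_add, hf, hg]
      rfl
    | single i m =>
      rw [evalMap_single]
      exact (h.polyDesc_single _ _ _ _ i m).trans (smulEnd_pow_apply W x h.commute_x i m).symm
  have hinj : Function.Injective f := by
    rw [injective_iff_map_eq_zero]
    intro v hv
    obtain ⟨v, rfl⟩ := (h.toPoly _).surjective v
    rw [hf', EmbeddingLike.map_eq_zero_iff] at hv
    rw [(injective_iff_map_eq_zero _).mp (charMap_injective xW) v hv, map_zero]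
  have hsurj : Function.Surjective g := fun w => by
    obtain ⟨v, hv⟩ := evalMap_surjective xW w
    exact ⟨h.toPoly yW v, (hg' v).trans hv⟩
  have hex : Function.Exact f g := by
    intro v
    obtain ⟨v, rfl⟩ := (h.toPoly _).surjective v
    rw [hg']
    refine (exact_charMap_evalMap xW v).trans ?_
    constructor
    · rintro ⟨w, rfl⟩
      exact ⟨h.toPoly _ w, hf' w⟩
    · rintro ⟨w, hw⟩
      obtain ⟨w, rfl⟩ := (h.toPoly _).surjective w
      exact ⟨w, (h.toPoly _).injective ((hf' w).symm.trans hw)⟩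
  exact hasProjectiveDimensionLT_of_exact (n := 1) hinj hex hsurj inferInstance
    (h.hasProjectiveDimensionLT_poly _ yW)

lemma projective_finsupp_nat (A M : Type u) [Ring A] [AddCommGroup M] [Module A M]
    [Module.Projective A M] : Module.Projective A (ℕ →₀ M) := by
  classical exact Module.Projective.of_equiv (finsuppLequivDFinsupp A).symm

/-- Ensures that passing to a syzygy over S also lowers the dimension over A. -/
lemma projective_restrictScalars_induced (M : Type u) [AddCommGroup M] [Module A M]
    [Module.Projective A M] :
    Module.Projective A ((ModuleCat.restrictScalars φ).obj (h.induced M)) :=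
  have := projective_finsupp_nat A M
  have := projective_finsupp_nat A (ℕ →₀ M)
  Module.Projective.of_equiv (M := ℕ →₀ ℕ →₀ M)
    ({ h.toPoly (shiftUp A M) with
        map_smul' := fun a v => (h.smul_toPoly _ a v).symm } :
      (ℕ →₀ ℕ →₀ M) ≃ₗ[A] (ModuleCat.restrictScalars φ).obj (h.induced M))

/-- Every `S`-module is a quotient of an induced module. -/
lemma exists_surjective_induced (h : IsOneSidedInverseExtension φ x y) (W : ModuleCat.{u} S) :
    ∃ (M : Type u) (_ : AddCommGroup M) (_ : Module A M) (_ : Module.Projective A M)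
      (g : h.induced M →ₗ[S] W), Function.Surjective g := by
  let π : (W →₀ A) →ₗ[A] (ModuleCat.restrictScalars φ).obj W :=
    Finsupp.linearCombination A id
  refine ⟨W →₀ A, inferInstance, inferInstance, inferInstance,
    h.inducedDesc (W := W) π.toAddMonoidHom π.map_smul,
    fun w => ⟨h.inducedMk (Finsupp.single w 1), ?_⟩⟩
  refine (h.inducedDesc_inducedMk π.toAddMonoidHom π.map_smul _).trans ?_
  exact (Finsupp.linearCombination_single A 1 w).trans (one_smul A _)

/-- The projective dimension over `S` exceeds the one over `A` by at most one. -/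
theorem hasProjectiveDimensionLT_succ (h : IsOneSidedInverseExtension φ x y)
    (W : ModuleCat.{u} S) (n : ℕ)
    (hW : HasProjectiveDimensionLT ((ModuleCat.restrictScalars φ).obj W) n) :
    HasProjectiveDimensionLT W (n + 1) := by
  -- The bounds are strict: 0 means zero and 1 means projective. A syzygy lowers the bound only as
  -- far as 1, so both are base cases.
  induction n using Nat.twoStepInduction generalizing W with
  | zero =>
    rw [hasProjectiveDimensionLT_zero_iff_isZero, ModuleCat.isZero_iff_subsingleton] at hW
    have : Subsingleton W := hW
    have := (ModuleCat.isZero_of_subsingleton W).hasProjectiveDimensionLT_zero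
    infer_instance
  | one =>
    have := projective_iff_hasProjectiveDimensionLT_one.mpr hW
    have : Module.Projective A ((ModuleCat.restrictScalars φ).obj W) := inferInstance
    exact h.hasProjectiveDimensionLT_two W
  | more n _ ih =>
    obtain ⟨M, _, _, _, g, hg⟩ := h.exists_surjective_induced W
    have := h.projective_induced (M := M)
    have := h.projective_restrictScalars_induced M
    have e := LinearMap.shortExact_shortComplexKer hg
    have e' : (g.shortComplexKer.map (ModuleCat.restrictScalars φ)).ShortExact :=
      ModuleCat.shortComplex_shortExact _
        ((ShortComplex.ShortExact.moduleCat_exact_iff_function_exact g.shortComplexKer).mp e.exact)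
        e.moduleCat_injective_f e.moduleCat_surjective_g
    have e₂ : Projective (g.shortComplexKer.map (ModuleCat.restrictScalars φ)).X₂ :=
      ModuleCat.projective_of_categoryTheory_projective
        ((ModuleCat.restrictScalars φ).obj (h.induced M))
    have := ih _ ((e'.hasProjectiveDimensionLT_X₃_iff n e₂).mp hW)
    exact (e.hasProjectiveDimensionLT_X₃_iff (n + 1)
      (ModuleCat.projective_of_categoryTheory_projective (h.induced M))).mpr this

end Sequences

/-! ### Lower bound: modules on which x and y act as the identity -/

section Trivial

variable (h : IsOneSidedInverseExtension φ x y)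
  (N : Type u) [AddCommGroup N] [Module A N]

/-- The `A`-module `N` as an `S`-module on which `x` and `y` act trivially. -/
noncomputable def trivial : ModuleCat.{u} S :=
  h.ofEnd (M := N) LinearMap.id LinearMap.id fun _ => rfl

/-- The underlying additive group of `trivial`. -/
noncomputable def toTrivial : N ≃+ h.trivial N := h.toOfEnd _ _ _

variable {N}

lemma smul_toTrivial (a : A) (m : N) : φ a • h.toTrivial N m = h.toTrivial N (a • m) :=
  h.smul_toOfEnd _ _ _ a m

lemma x_smul_trivial (w : h.trivial N) : x • w = w := by
  obtain ⟨w, rfl⟩ := (h.toTrivial N).surjective w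
  exact h.x_smul_toOfEnd _ _ _ w

lemma y_smul_trivial (w : h.trivial N) : y • w = w := by
  obtain ⟨w, rfl⟩ := (h.toTrivial N).surjective w
  exact h.y_smul_toOfEnd _ _ _ w

/-- Functoriality of `trivial`. -/
noncomputable def trivialMap {N' : Type u} [AddCommGroup N'] [Module A N'] (f : N →ₗ[A] N') :
    h.trivial N →ₗ[S] h.trivial N' :=
  h.ofEndDesc ((h.toTrivial N').toAddMonoidHom.comp f.toAddMonoidHom)
    (fun a m => by simp [smul_toTrivial]) (fun m => (h.x_smul_trivial _).symm)
    (fun m => (h.y_smul_trivial _).symm)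

@[simp]
lemma trivialMap_toTrivial {N' : Type u} [AddCommGroup N'] [Module A N'] (f : N →ₗ[A] N') (m : N) :
    h.trivialMap f (h.toTrivial N m) = h.toTrivial N' (f m) :=
  h.ofEndDesc_toOfEnd _ _ _ _ _

lemma trivialMap_injective {N' : Type u} [AddCommGroup N'] [Module A N'] {f : N →ₗ[A] N'}
    (hf : Function.Injective f) : Function.Injective (h.trivialMap f) := by
  rw [injective_iff_map_eq_zero]
  intro v hv
  obtain ⟨v, rfl⟩ := (h.toTrivial N).surjective v
  rw [trivialMap_toTrivial, EmbeddingLike.map_eq_zero_iff] at hv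
  rw [(injective_iff_map_eq_zero f).mp hf v hv, map_zero]

lemma trivialMap_surjective {N' : Type u} [AddCommGroup N'] [Module A N'] {f : N →ₗ[A] N'}
    (hf : Function.Surjective f) : Function.Surjective (h.trivialMap f) := fun w => by
  obtain ⟨w, rfl⟩ := (h.toTrivial N').surjective w
  obtain ⟨v, rfl⟩ := hf w
  exact ⟨_, h.trivialMap_toTrivial f v⟩

lemma trivialMap_exact {N' N'' : Type u} [AddCommGroup N'] [Module A N'] [AddCommGroup N'']
    [Module A N''] {f : N →ₗ[A] N'} {g : N' →ₗ[A] N''} (hfg : Function.Exact f g) :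
    Function.Exact (h.trivialMap f) (h.trivialMap g) := by
  intro v
  obtain ⟨v, rfl⟩ := (h.toTrivial N').surjective v
  rw [trivialMap_toTrivial, EmbeddingLike.map_eq_zero_iff, hfg v]
  constructor
  · rintro ⟨w, rfl⟩
    exact ⟨_, h.trivialMap_toTrivial f w⟩
  · rintro ⟨w, hw⟩
    obtain ⟨w, rfl⟩ := (h.toTrivial N).surjective w
    rw [trivialMap_toTrivial] at hw
    exact ⟨w, (h.toTrivial N').injective hw⟩

variable (N)

/-- The module `N × N` on which `x` acts by the shear `(a, b) ↦ (a + b, b)`. -/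
noncomputable def shear : ModuleCat.{u} S :=
  h.ofEnd (M := N × N) ((LinearMap.fst A N N + LinearMap.snd A N N).prod (LinearMap.snd A N N))
    ((LinearMap.fst A N N - LinearMap.snd A N N).prod (LinearMap.snd A N N)) fun _ => by simp

/-- The underlying additive group of `shear`. -/
noncomputable def toShear : N × N ≃+ h.shear N := h.toOfEnd _ _ _

lemma smul_toShear (a : A) (m : N × N) : φ a • h.toShear N m = h.toShear N (a • m) :=
  h.smul_toOfEnd _ _ _ a m

lemma x_smul_toShear (m : N × N) : x • h.toShear N m = h.toShear N (m.1 + m.2, m.2) :=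
  h.x_smul_toOfEnd _ _ _ m

/-- The projection from the shear module to the trivial module. -/
noncomputable def shearSnd : h.shear N →ₗ[S] h.trivial N :=
  h.ofEndDesc ((h.toTrivial N).toAddMonoidHom.comp (AddMonoidHom.snd N N))
    (fun a m => by simp [smul_toTrivial]) (fun m => (h.x_smul_trivial _).symm)
    (fun m => (h.y_smul_trivial _).symm)

@[simp]
lemma shearSnd_toShear (m : N × N) : h.shearSnd N (h.toShear N m) = h.toTrivial N m.2 :=
  h.ofEndDesc_toOfEnd _ _ _ _ _

lemma shearSnd_surjective : Function.Surjective (h.shearSnd N) := fun w => by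
  obtain ⟨w, rfl⟩ := (h.toTrivial N).surjective w
  exact ⟨h.toShear N (0, w), h.shearSnd_toShear N _⟩

/-- A section of the shear projection sends n to some (a, n). Since x fixes n, it must fix (a, n),
yet it moves it to (a + n, n); so n = 0. -/
lemma subsingleton_of_projective_trivial [Module.Projective S (h.trivial N)] :
    Subsingleton N := by
  obtain ⟨s, hs⟩ := Module.projective_lifting_property (h.shearSnd N) LinearMap.id
    (h.shearSnd_surjective N)
  refine subsingleton_of_forall_eq 0 fun n => ?_
  obtain ⟨⟨a, b⟩, hab⟩ := (h.toShear N).surjective (s (h.toTrivial N n))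
  have h₁ := LinearMap.congr_fun hs (h.toTrivial N n)
  rw [LinearMap.comp_apply, ← hab, shearSnd_toShear] at h₁
  obtain rfl : b = n := (h.toTrivial N).injective h₁
  have h₂ := s.map_smul x (h.toTrivial N b)
  rw [x_smul_trivial, ← hab, x_smul_toShear] at h₂
  simpa using congrArg Prod.fst ((h.toShear N).injective h₂)

variable {N} in
lemma trivial_symm_smul (a : A) (w : h.trivial N) :
    (h.toTrivial N).symm (φ a • w) = a • (h.toTrivial N).symm w := by
  rw [AddEquiv.symm_apply_eq, ← smul_toTrivial, AddEquiv.apply_symm_apply]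

variable {N} in
/-- Lifting to the shear module splits `x - 1` off a map to a trivial module. -/
lemma exists_shear_lift {Z : Type u} [AddCommGroup Z] [Module S Z] [Module.Projective S Z]
    (d : Z →ₗ[S] h.trivial N) :
    ∃ c : Z →+ N, (∀ a z, c (φ a • z) = a • c z) ∧
      ∀ z, c (x • z) = c z + (h.toTrivial N).symm (d z) := by
  obtain ⟨u, hu⟩ := Module.projective_lifting_property (h.shearSnd N) d (h.shearSnd_surjective N)
  let c : Z →+ N := (AddMonoidHom.fst N N).comp
    ((h.toShear N).symm.toAddMonoidHom.comp u.toAddMonoidHom)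
  have hcu (z : Z) : u z = h.toShear N (c z, (h.toTrivial N).symm (d z)) := by
    obtain ⟨⟨a, b⟩, hab⟩ := (h.toShear N).surjective (u z)
    have h₁ : h.toTrivial N b = d z := by
      rw [← LinearMap.congr_fun hu z, LinearMap.comp_apply, ← hab, shearSnd_toShear]
    simp [c, ← hab, ← h₁]
  refine ⟨c, fun a z => ?_, fun z => ?_⟩
  · have := u.map_smul (φ a) z
    rw [hcu, hcu, smul_toShear] at this
    exact congrArg Prod.fst ((h.toShear N).injective this)
  · have := u.map_smul x z
    rw [hcu, hcu, x_smul_toShear] at this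
    exact congrArg Prod.fst ((h.toShear N).injective this)

/-- A module is projective if some presentation of it maps compatibly to a projective module over
it, killing the relations. -/
lemma projective_of_ker_le {R P : Type u} [AddCommGroup R] [Module A R] [AddCommGroup P]
    [Module A P] [Module.Projective A P] {N : Type u} [AddCommGroup N] [Module A N]
    (q : R →ₗ[A] N) (hq : Function.Surjective q) (σ : R →ₗ[A] P)
    (p : P →ₗ[A] N) (hσ : LinearMap.ker q ≤ LinearMap.ker σ) (hp : ∀ r, p (σ r) = q r) :
    Module.Projective A N := by
  refine Module.Projective.of_split ((LinearMap.ker q).liftQ σ hσ ∘ₗ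
    (q.quotKerEquivOfSurjective hq).symm.toLinearMap) p (LinearMap.ext fun n => ?_)
  obtain ⟨r, rfl⟩ := hq n
  have : (q.quotKerEquivOfSurjective hq).symm (q r) = (LinearMap.ker q).mkQ r :=
    (LinearEquiv.symm_apply_eq _).mpr rfl
  simp [this, hp]

variable {N} in
/-- A length one projective resolution of a trivial module yields projectivity over `A`. -/
lemma projective_of_surjective_trivial {R : Type u} [AddCommGroup R] [Module S R]
    [Module.Projective S R] (q : R →ₗ[S] h.trivial N) (hq : Function.Surjective q)
    [Module.Projective S (LinearMap.ker q)] {P : Type u} [AddCommGroup P] [Module A P]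
    [Module.Projective A P] (p : P →ₗ[A] N) (hp : Function.Surjective p) :
    Module.Projective A N := by
  obtain ⟨k, hk⟩ := Module.projective_lifting_property (h.trivialMap p) q
    (h.trivialMap_surjective hp)
  have hpk (r : R) : p ((h.toTrivial P).symm (k r)) = (h.toTrivial N).symm (q r) := by
    rw [← LinearMap.congr_fun hk r, AddEquiv.eq_symm_apply, LinearMap.comp_apply,
      ← trivialMap_toTrivial, AddEquiv.apply_symm_apply]
  -- `k` covers `q`, so it carries the kernel of `q` into that of `p`; this restriction is the `d`
  -- below.
  let e : LinearMap.ker q →+ LinearMap.ker p :=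
    AddMonoidHom.mk' (fun z => ⟨(h.toTrivial P).symm (k z), by
      rw [LinearMap.mem_ker, hpk, LinearMap.mem_ker.mp z.2, map_zero]⟩)
      (fun z z' => Subtype.ext (by simp))
  have heφ (a : A) (z : LinearMap.ker q) : e (φ a • z) = a • e z :=
    Subtype.ext (by simp [e, trivial_symm_smul])
  have hex (z : LinearMap.ker q) : e (x • z) = e z := Subtype.ext (by simp [e, x_smul_trivial])
  have hey (z : LinearMap.ker q) : e (y • z) = e z := Subtype.ext (by simp [e, y_smul_trivial])
  let d : LinearMap.ker q →ₗ[S] h.trivial (LinearMap.ker p) :=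
    h.linearMap ((h.toTrivial (LinearMap.ker p)).toAddMonoidHom.comp e)
      (fun a z => by simp [heφ, smul_toTrivial])
      (fun z => by simp [hex, x_smul_trivial])
      (fun z => by simp [hey, y_smul_trivial])
  have hd (z : LinearMap.ker q) :
      ((h.toTrivial (LinearMap.ker p)).symm (d z) : P) = (h.toTrivial P).symm (k z) := by
    simp [d, e]
  -- Projectivity of the kernel of `q` gives c(xz) - c(z) = d(z).
  obtain ⟨c, hcφ, hcx⟩ := h.exists_shear_lift d
  -- x acts as the identity on the target of `q`, so x r - r lies in its kernel.
  let τ : R →+ LinearMap.ker q := AddMonoidHom.mk' (fun r => ⟨x • r - r, by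
    simp [x_smul_trivial]⟩) (fun r r' => Subtype.ext (by simp; abel))
  have hτφ (a : A) (r : R) : τ (φ a • r) = φ a • τ r := Subtype.ext (by
    simp [τ, smul_sub, ← mul_smul, (h.commute_x a).eq])
  have hτ (z : LinearMap.ker q) : τ z = x • z - z := rfl
  let := Module.compHom R φ
  have hsmul (a : A) (r : R) : a • r = φ a • r := rfl
  -- On the kernel of `q` the correction c(xz - z) = d(z) cancels k(z), so σ descends to N. The
  -- correction takes values in the kernel of `p`, so σ still covers `q` and the descended map
  -- splits `p`.
  let σ : R →ₗ[A] P :=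
    { toFun r := (h.toTrivial P).symm (k r) - (c (τ r) : P)
      map_add' r r' := by
        simp only [map_add, Submodule.coe_add]
        abel
      map_smul' a r := by
        rw [hsmul, map_smul, trivial_symm_smul, hτφ, hcφ, Submodule.coe_smul, RingHom.id_apply,
          smul_sub] }
  let q' : R →ₗ[A] N :=
    { toFun r := (h.toTrivial N).symm (q r)
      map_add' r r' := by simp
      map_smul' a r := by rw [hsmul, map_smul, trivial_symm_smul, RingHom.id_apply] }
  refine projective_of_ker_le q' ((h.toTrivial N).symm.surjective.comp hq) σ p
    (fun r hr => ?_) (fun r => ?_)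
  · have hr : r ∈ LinearMap.ker q := (h.toTrivial N).symm.map_eq_zero_iff.mp hr
    change (h.toTrivial P).symm (k r) - (c (τ r) : P) = 0
    rw [hτ ⟨r, hr⟩, map_sub, hcx, add_sub_cancel_left, hd, sub_self]
  · change p ((h.toTrivial P).symm (k r) - (c (τ r) : P)) = _
    rw [map_sub, LinearMap.mem_ker.mp (c _).2, sub_zero, hpk]
    rfl

lemma projective_of_hasProjectiveDimensionLT_two_trivial
    (hN : HasProjectiveDimensionLT (h.trivial N) 2) : Module.Projective A N := by
  obtain ⟨M, _, _, _, q, hq⟩ := h.exists_surjective_induced (h.trivial N)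
  have := h.projective_induced (M := M)
  have : Module.Projective S (LinearMap.ker q) := by
    have := ((LinearMap.shortExact_shortComplexKer hq).hasProjectiveDimensionLT_X₃_iff 0
      (ModuleCat.projective_of_categoryTheory_projective (h.induced M))).mp hN
    have : Projective (ModuleCat.of S (LinearMap.ker q)) :=
      projective_iff_hasProjectiveDimensionLT_one.mpr this
    exact (IsProjective.iff_projective _).mpr this
  exact h.projective_of_surjective_trivial q hq (Finsupp.linearCombination A (id : N → N))
    (Finsupp.linearCombination_id_surjective A N)

/-- A short exact sequence of `A`-modules gives one of trivial modules. -/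
lemma shortExact_trivialMap_subtype_ker {P N : Type u} [AddCommGroup P] [Module A P]
    [AddCommGroup N] [Module A N] (p : P →ₗ[A] N) (hp : Function.Surjective p) :
    (ModuleCat.shortComplexOfCompEqZero (h.trivialMap (LinearMap.ker p).subtype) (h.trivialMap p)
      (h.trivialMap_exact p.exact_subtype_ker_map).linearMap_comp_eq_zero).ShortExact :=
  ModuleCat.shortComplex_shortExact _ (h.trivialMap_exact p.exact_subtype_ker_map)
    (h.trivialMap_injective (LinearMap.ker p).injective_subtype) (h.trivialMap_surjective hp)

lemma hasProjectiveDimensionLT_trivial_two (P : Type u) [AddCommGroup P] [Module A P]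
    [Module.Projective A P] : HasProjectiveDimensionLT (h.trivial P) 2 := by
  have : Module.Projective A ((ModuleCat.restrictScalars φ).obj (h.trivial P)) :=
    Module.Projective.of_equiv (M := P)
      ({ h.toTrivial P with map_smul' := fun a v => (h.smul_toTrivial a v).symm } :
        P ≃ₗ[A] (ModuleCat.restrictScalars φ).obj (h.trivial P))
  exact h.hasProjectiveDimensionLT_two (h.trivial P)

/-- The projective dimension of the trivial module over `S` exceeds that of `N` over `A`. -/
theorem hasProjectiveDimensionLT_of_trivial (n : ℕ)
    (hN : HasProjectiveDimensionLT (h.trivial N) (n + 1)) :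
    HasProjectiveDimensionLT (ModuleCat.of A N) n := by
  induction n using Nat.twoStepInduction generalizing N with
  | zero =>
    have := projective_iff_hasProjectiveDimensionLT_one.mpr hN
    have : Module.Projective S (h.trivial N) := inferInstance
    have := h.subsingleton_of_projective_trivial N
    exact (ModuleCat.isZero_of_subsingleton _).hasProjectiveDimensionLT_zero
  | one =>
    have : Module.Projective A (ModuleCat.of A N) :=
      h.projective_of_hasProjectiveDimensionLT_two_trivial N hN
    infer_instance
  | more n _ ih =>
    let p : (N →₀ A) →ₗ[A] N := Finsupp.linearCombination A id
    have hp : Function.Surjective p := Finsupp.linearCombination_id_surjective A N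
    have h₂ := h.hasProjectiveDimensionLT_trivial_two (N →₀ A)
    -- The middle term is not projective, only of dimension at most 1, so this shift needs a bound
    -- of at least 2 on it.
    have h₁ := (h.shortExact_trivialMap_subtype_ker p hp).hasProjectiveDimensionLT_X₁ (n + 2)
      (hasProjectiveDimensionLT_of_ge _ 2 (n + 2) (by omega)) hN
    exact ((LinearMap.shortExact_shortComplexKer hp).hasProjectiveDimensionLT_X₃_iff n
      (ModuleCat.projective_of_categoryTheory_projective (ModuleCat.of A (N →₀ A)))).mpr
        (ih (LinearMap.ker p) h₁)

end Trivial

/-! ### Arithmetic with the value ⊥, and the one-step formula -/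

lemma add_one_le_of_lt_imp {a b : WithBot ℕ∞} (h : ∀ n : ℕ, b < (n + 1 : ℕ) → a < n) :
    a + 1 ≤ b := by
  induction b with
  | bot =>
    have : a < (0 : ℕ) := h 0 (WithBot.bot_lt_coe _)
    obtain rfl : a = ⊥ := (WithBot.lt_zero_iff_eq_bot _).mp this
    simp
  | coe b =>
    induction b with
    | top => simp
    | coe n =>
      have := h n (by norm_cast; omega)
      induction a with
      | bot => simp
      | coe a =>
        induction a with
        | top => simp at this
        | coe a =>
          norm_cast at this ⊢

/-- The case b = ⊥ needs its own hypothesis: there `h` yields only a < 1, which does not exclude a =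
0. -/
lemma le_add_one_of_lt_imp {a b : WithBot ℕ∞} (h₀ : b = ⊥ → a = ⊥)
    (h : ∀ n : ℕ, b < n → a < (n + 1 : ℕ)) : a ≤ b + 1 := by
  induction b with
  | bot => simp [h₀ rfl]
  | coe b =>
    induction b with
    | top => exact le_top
    | coe n =>
      have := h (n + 1) (by norm_cast; omega)
      exact ENat.WithBot.lt_add_one_iff.mp this

lemma iSup_add_one_le {ι : Type*} {f : ι → WithBot ℕ∞} {c : WithBot ℕ∞} (h : ∀ i, f i + 1 ≤ c) :
    (⨆ i, f i) + 1 ≤ c := by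
  induction c with
  | bot =>
    have h' (i) : f i = ⊥ := by simpa using h i
    simp [h']
  | coe c =>
    induction c with
    | top => exact le_top
    | coe n =>
      cases n with
      | zero =>
        have h' (i) : f i = ⊥ := (ENat.WithBot.add_one_le_zero_iff _).mp (h i)
        simp [h']
      | succ n =>
        have h' (i) : f i ≤ n :=
          ENat.WithBot.lt_add_one_iff.mp (ENat.WithBot.add_one_le_natCast_iff.mp (h i))
        exact (add_le_add_left (iSup_le h') 1).trans (by norm_cast)

/-- Adjoining a one-sided inverse pair raises the left global dimension by one. -/
theorem leftGlobalDimension_eq (h : IsOneSidedInverseExtension φ x y) :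
    leftGlobalDimension S = leftGlobalDimension A + 1 := by
  refine le_antisymm (iSup_le fun W => ?_) (iSup_add_one_le fun N => ?_)
  · refine le_trans (le_add_one_of_lt_imp (fun hW => ?_) fun n hn => ?_) (add_le_add_left
      (le_iSup (fun N : ModuleCat.{u} A => projectiveDimension N)
        ((ModuleCat.restrictScalars φ).obj W)) 1)
    -- The zero module: W and its restriction have the same underlying set.
    · rw [projectiveDimension_eq_bot_iff, ModuleCat.isZero_iff_subsingleton] at hW ⊢
      exact hW
    rw [projectiveDimension_lt_iff] at hn ⊢
    exact h.hasProjectiveDimensionLT_succ W n hn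
  · refine le_trans (add_one_le_of_lt_imp fun n hn => ?_)
      (le_iSup (fun W : ModuleCat.{u} S => projectiveDimension W) (h.trivial N))
    rw [projectiveDimension_lt_iff] at hn ⊢
    exact h.hasProjectiveDimensionLT_of_trivial N n hn

end IsOneSidedInverseExtension

/-! ### Invariance under ring isomorphism -/

lemma leftGlobalDimension_le_of_ringEquiv {R R' : Type u} [Ring R] [Ring R'] (e : R ≃+* R') :
    leftGlobalDimension R' ≤ leftGlobalDimension R := by
  refine iSup_le fun M => ?_
  let _ := RingHomInvPair.of_ringEquiv e
  let N := (ModuleCat.restrictScalars e.toRingHom).obj M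
  have := RingHomInvPair.symm (RingHomClass.toRingHom e) (RingHomClass.toRingHom e.symm)
  let e' : N ≃ₛₗ[RingHomClass.toRingHom e] M :=
    { AddEquiv.refl M with map_smul' := fun r m => rfl }
  rw [← ModuleCat.projectiveDimension_eq_of_semiLinearEquiv e e']
  exact le_iSup (fun N : ModuleCat.{u} R => CategoryTheory.projectiveDimension N) N

lemma leftGlobalDimension_eq_of_ringEquiv {R R' : Type u} [Ring R] [Ring R'] (e : R ≃+* R') :
    leftGlobalDimension R = leftGlobalDimension R' :=
  le_antisymm (leftGlobalDimension_le_of_ringEquiv e.symm) (leftGlobalDimension_le_of_ringEquiv e)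

/-! ### The presented algebra as an iterated extension -/

namespace OneSidedInverseAlgebra

open OneSidedInverses

variable (A : Type u) [Ring A] (n : ℕ)

/-- The inclusion of the coefficients. -/
noncomputable def coeff : A →+* OneSidedInverseAlgebra A n :=
  (RingQuot.mkRingHom (Rel A n)).comp MonoidAlgebra.singleOneRingHom

/-- The generator `x i`. -/
noncomputable def X (i : Fin n) : OneSidedInverseAlgebra A n :=
  RingQuot.mkRingHom (Rel A n) (freeX A n i)

/-- The generator `y i`. -/
noncomputable def Y (i : Fin n) : OneSidedInverseAlgebra A n :=
  RingQuot.mkRingHom (Rel A n) (freeY A n i)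

variable {A n}

lemma commute_X (a : A) (i : Fin n) : Commute (coeff A n a) (X A n i) := by
  refine Commute.map (f := RingQuot.mkRingHom (Rel A n)) ?_
  simp [commute_iff_eq, freeX, MonoidAlgebra.single_mul_single]

lemma commute_Y (a : A) (i : Fin n) : Commute (coeff A n a) (Y A n i) := by
  refine Commute.map (f := RingQuot.mkRingHom (Rel A n)) ?_
  simp [commute_iff_eq, freeY, MonoidAlgebra.single_mul_single]

lemma Y_mul_X (i : Fin n) : Y A n i * X A n i = 1 := by
  rw [X, Y, ← map_mul, RingQuot.mkRingHom_rel (Rel.left_inverse i), map_one]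

lemma commute_X_Y {i j : Fin n} (h : i ≠ j) : Commute (X A n i) (Y A n j) := by
  rw [commute_iff_eq, X, Y, ← map_mul, RingQuot.mkRingHom_rel (Rel.comm_xy i j h), map_mul]

lemma commute_X_X {i j : Fin n} (h : i ≠ j) : Commute (X A n i) (X A n j) := by
  rw [commute_iff_eq, X, X, ← map_mul, RingQuot.mkRingHom_rel (Rel.comm_xx i j h), map_mul]

lemma commute_Y_Y {i j : Fin n} (h : i ≠ j) : Commute (Y A n i) (Y A n j) := by
  rw [commute_iff_eq, Y, Y, ← map_mul, RingQuot.mkRingHom_rel (Rel.comm_yy i j h), map_mul]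

/-- The algebra is generated by the coefficients and the generators. -/
lemma subring_eq_top (p : Subring (OneSidedInverseAlgebra A n)) (hA : ∀ a, coeff A n a ∈ p)
    (hX : ∀ i, X A n i ∈ p) (hY : ∀ i, Y A n i ∈ p) : p = ⊤ := by
  rw [eq_top_iff]
  intro s _
  obtain ⟨f, rfl⟩ := RingQuot.mkRingHom_surjective _ s
  have hw (w : FreeMonoid (Fin n ⊕ Fin n)) :
      RingQuot.mkRingHom (Rel A n) (MonoidAlgebra.of A _ w) ∈ p := by
    induction w using FreeMonoid.inductionOn with
    | one => rw [map_one, map_one]; exact one_mem p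
    | of i => exact i.casesOn hX hY
    | mul v w hv hw => rw [map_mul, map_mul]; exact mul_mem hv hw
  induction f using MonoidAlgebra.induction_linear with
  | zero => rw [map_zero]; exact zero_mem p
  | add f g hf hg => rw [map_add]; exact add_mem (hf trivial) (hg trivial)
  | single w a =>
    have : MonoidAlgebra.single w a =
        MonoidAlgebra.singleOneRingHom a * MonoidAlgebra.of A _ w := by
      simp [MonoidAlgebra.single_mul_single]
    rw [this, map_mul]
    exact mul_mem (hA a) (hw w)

lemma hom_ext {B : Type*} [Ring B] {f g : OneSidedInverseAlgebra A n →+* B}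
    (hA : ∀ a, f (coeff A n a) = g (coeff A n a)) (hX : ∀ i, f (X A n i) = g (X A n i))
    (hY : ∀ i, f (Y A n i) = g (Y A n i)) : f = g := by
  have := subring_eq_top (f.eqLocus g) hA hX hY
  exact RingHom.ext fun s => (this ▸ Subring.mem_top s : s ∈ f.eqLocus g)

/-- The universal property. -/
lemma exists_lift {B : Type*} [Ring B] (f : A →+* B) (x y : Fin n → B)
    (hx : ∀ a i, Commute (f a) (x i)) (hy : ∀ a i, Commute (f a) (y i))
    (hyx : ∀ i, y i * x i = 1) (hxy : ∀ i j, i ≠ j → Commute (x i) (y j))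
    (hxx : ∀ i j, i ≠ j → Commute (x i) (x j)) (hyy : ∀ i j, i ≠ j → Commute (y i) (y j)) :
    ∃ g : OneSidedInverseAlgebra A n →+* B,
      (∀ a, g (coeff A n a) = f a) ∧ (∀ i, g (X A n i) = x i) ∧ ∀ i, g (Y A n i) = y i := by
  let w : FreeMonoid (Fin n ⊕ Fin n) →* B := FreeMonoid.lift (Sum.elim x y)
  have hw (a : A) (v) : Commute (f a) (w v) := by
    induction v using FreeMonoid.inductionOn with
    | one => simp
    | of i => cases i <;> simp [w, hx, hy]
    | mul u v hu hv => rw [map_mul]; exact hu.mul_right hv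
  let g₀ : FreeRing A n →+* B := MonoidAlgebra.liftNCRingHom f w hw
  have hX (i) : g₀ (freeX A n i) = x i := by simp [g₀, freeX, w]
  have hY (i) : g₀ (freeY A n i) = y i := by simp [g₀, freeY, w]
  have hrel : ∀ ⦃u v⦄, Rel A n u v → g₀ u = g₀ v := by
    intro u v huv
    induction huv with
    | left_inverse i => rw [map_mul, hX, hY, map_one, hyx]
    | comm_xy i j h => rw [map_mul, map_mul, hX, hY, (hxy i j h).eq]
    | comm_xx i j h => rw [map_mul, map_mul, hX, hX, (hxx i j h).eq]
    | comm_yy i j h => rw [map_mul, map_mul, hY, hY, (hyy i j h).eq]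
  refine ⟨RingQuot.lift ⟨g₀, hrel⟩, fun a => ?_, fun i => ?_, fun i => ?_⟩
  · simp [coeff, g₀]
  · rw [X, RingQuot.lift_mkRingHom_apply, hX]
  · rw [Y, RingQuot.lift_mkRingHom_apply, hY]

/-- With no generators the algebra is the coefficient ring. -/
lemma nonempty_ringEquiv_zero : Nonempty (A ≃+* OneSidedInverseAlgebra A 0) := by
  obtain ⟨g, hg, -⟩ := exists_lift (n := 0) (RingHom.id A) Fin.elim0 Fin.elim0
    (fun _ i => i.elim0) (fun _ i => i.elim0) (fun i => i.elim0) (fun i => i.elim0)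
    (fun i => i.elim0) (fun i => i.elim0)
  exact ⟨RingEquiv.ofRingHom (coeff A 0) g
    (hom_ext (fun a => by simp [hg]) (fun i => i.elim0) (fun i => i.elim0))
    (RingHom.ext fun a => hg a)⟩

/-- The algebra on `n + 1` pairs of generators arises from the one on `n` pairs by adjoining the
last pair. -/
lemma exists_extension_succ (A : Type u) [Ring A] (n : ℕ) :
    ∃ (φ : OneSidedInverseAlgebra A n →+* OneSidedInverseAlgebra A (n + 1))
      (x y : OneSidedInverseAlgebra A (n + 1)), IsOneSidedInverseExtension φ x y := by
  have hne {i j : Fin n} (h : i ≠ j) : i.castSucc ≠ j.castSucc :=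
    fun e => h (Fin.castSucc_injective n e)
  have hlast (i : Fin n) : i.castSucc ≠ Fin.last n := (Fin.castSucc_lt_last i).ne
  obtain ⟨φ, hφA, hφX, hφY⟩ := exists_lift (coeff A (n + 1)) (fun i : Fin n => X A _ i.castSucc)
    (fun i => Y A _ i.castSucc) (fun a i => commute_X a _) (fun a i => commute_Y a _)
    (fun i => Y_mul_X _) (fun i j h => commute_X_Y (hne h)) (fun i j h => commute_X_X (hne h))
    (fun i j h => commute_Y_Y (hne h))
  -- The preimage of a centralizer is a subring, so commutation with `b` need only be checked on
  -- generators.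
  have hcomm {B : Type u} [Ring B] (f : OneSidedInverseAlgebra A n →+* B) (b : B)
      (hA : ∀ a, Commute (f (coeff A n a)) b) (hX : ∀ i, Commute (f (X A n i)) b)
      (hY : ∀ i, Commute (f (Y A n i)) b) (s) : Commute (f s) b := by
    have := subring_eq_top ((Subring.centralizer {b}).comap f)
      (fun a => by simpa [Subring.mem_centralizer_iff] using (hA a).eq.symm)
      (fun a => by simpa [Subring.mem_centralizer_iff] using (hX a).eq.symm)
      (fun a => by simpa [Subring.mem_centralizer_iff] using (hY a).eq.symm)
    have hs : s ∈ (Subring.centralizer {b}).comap f := this ▸ Subring.mem_top s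
    simpa [Subring.mem_centralizer_iff, commute_iff_eq, eq_comm] using hs
  refine ⟨φ, X A _ (Fin.last n), Y A _ (Fin.last n), ⟨fun s => ?_, fun s => ?_, Y_mul_X _,
    fun p hφ hx hy => ?_, fun {B} _ f x y hx hy hyx => ?_⟩⟩
  · refine hcomm φ _ (fun a => ?_) (fun i => ?_) (fun i => ?_) s
    · rw [hφA]; exact commute_X _ _
    · rw [hφX]; exact commute_X_X (hlast i)
    · rw [hφY]; exact (commute_X_Y (hlast i).symm).symm
  · refine hcomm φ _ (fun a => ?_) (fun i => ?_) (fun i => ?_) s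
    · rw [hφA]; exact commute_Y _ _
    · rw [hφX]; exact commute_X_Y (hlast i)
    · rw [hφY]; exact commute_Y_Y (hlast i)
  · refine subring_eq_top p (fun a => hφA a ▸ hφ _) (fun i => ?_) (fun i => ?_)
    · exact Fin.lastCases hx (fun i => hφX i ▸ hφ _) i
    · exact Fin.lastCases hy (fun i => hφY i ▸ hφ _) i
  · have key {u v : OneSidedInverseAlgebra A n} (h : Commute u v) : Commute (f u) (f v) := h.map f
    -- The new pair goes to the last index. Relations between two old indices come from `f`, and
    -- mixed ones from `hx` and `hy`.
    obtain ⟨g, hgA, hgX, hgY⟩ := exists_lift (n := n + 1) (f.comp (coeff A n))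
      (Fin.lastCases x fun i => f (X A n i)) (Fin.lastCases y fun i => f (Y A n i))
      (fun a i => by cases i using Fin.lastCases <;> simp [hx, key (commute_X a _)])
      (fun a i => by cases i using Fin.lastCases <;> simp [hy, key (commute_Y a _)])
      (fun i => by cases i using Fin.lastCases <;> simp [hyx, ← map_mul, Y_mul_X])
      (fun i j h => by
        cases i using Fin.lastCases <;> cases j using Fin.lastCases
        · exact absurd rfl h
        · simpa using (hx _).symm
        · simpa using hy _
        · simpa using key (commute_X_Y fun e => h (congrArg _ e)))
      (fun i j h => by
        cases i using Fin.lastCases <;> cases j using Fin.lastCases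
        · exact absurd rfl h
        · simpa using (hx _).symm
        · simpa using hx _
        · simpa using key (commute_X_X fun e => h (congrArg _ e)))
      (fun i j h => by
        cases i using Fin.lastCases <;> cases j using Fin.lastCases
        · exact absurd rfl h
        · simpa using (hy _).symm
        · simpa using hy _
        · simpa using key (commute_Y_Y fun e => h (congrArg _ e)))
    refine ⟨g, hom_ext (fun a => ?_) (fun i => ?_) (fun i => ?_), ?_, ?_⟩
    · simp [hφA, hgA]
    · simp [hφX, hgX]
    · simp [hφY, hgY]
    · simp [hgX]
    · simp [hgY]

end OneSidedInverseAlgebra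

theorem theorem2 (A : Type u) [Ring A] (n : ℕ) :
    leftGlobalDimension (OneSidedInverseAlgebra A n) = leftGlobalDimension A + n ∧
      rightGlobalDimension (OneSidedInverseAlgebra A n) = rightGlobalDimension A + n := by
  induction n with
  | zero =>
    obtain ⟨e⟩ := OneSidedInverseAlgebra.nonempty_ringEquiv_zero (A := A)
    simp [rightGlobalDimension, leftGlobalDimension_eq_of_ringEquiv e,
      leftGlobalDimension_eq_of_ringEquiv e.op]
  | succ n ih =>
    obtain ⟨φ, x, y, h⟩ := OneSidedInverseAlgebra.exists_extension_succ A n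
    rw [rightGlobalDimension, h.leftGlobalDimension_eq, h.op.leftGlobalDimension_eq,
      ← rightGlobalDimension, ih.1, ih.2]
    simp [add_assoc]
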